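/- Let $H_1, H_2$ be complex Hilbert spaces, let $A_1 : \operatorname{dom}(A_1) \subseteq H_1 \times H_2 \to H_1$ and $A_{21} : \operatorname{dom}(A_{21}) \subseteq H_1 \to H_2$ be linear operators (not assumed densely defined or closed), and let $S : H_2 \to H_2$ be a bounded linear operator which is coercive, i.e. there is $\nu > 0$ with $\operatorname{Re}\langle h, S h\rangle \ge \nu \|h\|^2$ for all $h \in H_2$. Define the operator $A_{\mathrm{ext}}$ on the Hilbert space $H_1 \times H_2$ by $$\operatorname{dom}(A_{\mathrm{ext}}) = \{(h_1,h_2) \in \operatorname{dom}(A_1) : h_1 \in \operatorname{dom}(A_{21})\}, \qquad A_{\mathrm{ext}}(h_1,h_2) = \big(A_1(h_1,h_2),\, A_{21}h_1\big),$$ and the operator $A_S$ on $H_1$ by $$\operatorname{dom}(A_S) = \{h_1 \in \operatorname{dom}(A_{21}) : (h_1, S A_{21}h_1) \in \operatorname{dom}(A_1)\}, \qquad A_S h_1 = A_1(h_1, S A_{21} h_1).$$ Suppose that $\operatorname{dom}(A_1) = \operatorname{dom}(A_{11}) \times \operatorname{dom}(A_{12})$ and $A_1(h_1,h_2) = A_{11}h_1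 + A_{12}h_2$ there, for linear operators $A_{11} : \operatorname{dom}(A_{11}) \subseteq H_1 \to H_1$ and $A_{12} : \operatorname{dom}(A_{12}) \subseteq H_2 \to H_1$ (the splitting assumption), and that $A_{11}$ is everywhere defined and bounded. Then the following are equivalent: (i) The operators $A_{21}$ and $A_{12}$ are densely defined and closed and satisfy $A_{12} = -A_{21}^*$ (including equality of domains); moreover, $A_{11}$ is dissipative, i.e. $\operatorname{Re}\langle A_{11}h, h\rangle \le 0$ for all $h \in H_1$. (ii) The operator $A_{\mathrm{ext}}$ generates a contractive $C_0$-semigroup on $H_1 \times H_2$. If these equivalent assertions hold, then $$\operatorname{dom}(A_S) = \{h_1 \in \operatorname{dom}(A_{21}) : S A_{21} h_1 \in \operatorname{dom}(A_{21}^*)\} \quad\text{and}\quad A_S h_1 = A_{11}h_1 - A_{21}^* S A_{21} h_1$$ for all $h_1 \in \operatorname{dom}(A_S)$. -/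

import Mathlib

open Filter Topology
open scoped NNReal LinearPMap

noncomputable section

namespace ClosureRelation

/-! The Hilbert space product of `H₁` and `H₂` is `WithLp 2 (H₁ × H₂)`, whose inner product is the
sum of the inner products of the components. Unbounded operators are `LinearPMap`s. -/

/-- A bounded operator `S` is coercive if `Re ⟪h, S h⟫ ≥ ν ‖h‖²` for some `ν > 0` and all `h`. -/
def IsCoerciveOp {H : Type*} [NormedAddCommGroup H] [InnerProductSpace ℂ H]
    (S : H →L[ℂ] H) : Prop :=
  ∃ ν : ℝ, 0 < ν ∧ ∀ h : H, ν * ‖h‖ ^ 2 ≤ (inner ℂ h (S h)).re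

/-- An unbounded operator `A` on `H` is dissipative if `Re ⟪A x, x⟫ ≤ 0` for all `x ∈ dom A`. -/
def IsDissipative {H : Type*} [NormedAddCommGroup H] [InnerProductSpace ℂ H]
    (A : H →ₗ.[ℂ] H) : Prop :=
  ∀ x : A.domain, (inner ℂ (A x) (x : H)).re ≤ 0

/-- The operator `A` is everywhere defined and bounded. -/
def IsEverywhereBounded {E F : Type*} [NormedAddCommGroup E] [NormedSpace ℂ E]
    [NormedAddCommGroup F] [NormedSpace ℂ F] (A : E →ₗ.[ℂ] F) : Prop :=
  A.domain = ⊤ ∧ ∃ C : ℝ, ∀ x : A.domain, ‖A x‖ ≤ C * ‖(x : E)‖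

/-- A `C₀`-semigroup of contractions on `X`: a family `(T t)_{t ≥ 0}` of linear contractions with
the semigroup property and continuous orbits. -/
structure IsContractionSemigroup {X : Type*} [NormedAddCommGroup X] [NormedSpace ℂ X]
    (T : ℝ≥0 → X →L[ℂ] X) : Prop where
  map_zero : T 0 = ContinuousLinearMap.id ℂ X
  map_add : ∀ s t : ℝ≥0, T (s + t) = (T s).comp (T t)
  continuous_orbit : ∀ x : X, Continuous fun t : ℝ≥0 => T t x
  contractive : ∀ t : ℝ≥0, ‖T t‖ ≤ 1

/-- `A` is the (infinitesimal) generator of `T`: a vector `x` lies in `dom A` with `A x = y` if and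
only if `(T t x - x) / t → y` as `t ↓ 0`. -/
def IsGenerator {X : Type*} [NormedAddCommGroup X] [NormedSpace ℂ X]
    (A : X →ₗ.[ℂ] X) (T : ℝ≥0 → X →L[ℂ] X) : Prop :=
  ∀ x y : X, (x, y) ∈ A.graph ↔
    Tendsto (fun t : ℝ≥0 => (((t : ℝ) : ℂ))⁻¹ • (T t x - x)) (𝓝[>] 0) (𝓝 y)

/-- `A` generates a contractive `C₀`-semigroup. -/
def GeneratesContractionSemigroup {X : Type*} [NormedAddCommGroup X] [NormedSpace ℂ X]
    (A : X →ₗ.[ℂ] X) : Prop :=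
  ∃ T : ℝ≥0 → X →L[ℂ] X, IsContractionSemigroup T ∧ IsGenerator A T

section Operators

variable {H₁ H₂ : Type*} [NormedAddCommGroup H₁] [InnerProductSpace ℂ H₁]
  [NormedAddCommGroup H₂] [InnerProductSpace ℂ H₂]

/-- The extended operator on `H₁ × H₂`, `(h₁, h₂) ↦ (A₁ (h₁, h₂), A₂₁ h₁)`, with domain
`{(h₁, h₂) ∈ dom A₁ | h₁ ∈ dom A₂₁}`. -/
def Aext (A₁ : WithLp 2 (H₁ × H₂) →ₗ.[ℂ] H₁) (A₂₁ : H₁ →ₗ.[ℂ] H₂) :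
    WithLp 2 (H₁ × H₂) →ₗ.[ℂ] WithLp 2 (H₁ × H₂) where
  domain := A₁.domain ⊓ A₂₁.domain.comap (WithLp.fstₗ 2 ℂ H₁ H₂)
  toFun :=
    { toFun := fun x => WithLp.toLp 2 (A₁ ⟨x.1, x.2.1⟩, A₂₁ ⟨x.1.fst, x.2.2⟩)
      map_add' := fun x y => by
        have h₁ := A₁.map_add ⟨x.1, x.2.1⟩ ⟨y.1, y.2.1⟩
        have h₂ := A₂₁.map_add ⟨x.1.fst, x.2.2⟩ ⟨y.1.fst, y.2.2⟩
        rw [← WithLp.toLp_add, Prod.mk_add_mk, ← h₁, ← h₂]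
        rfl
      map_smul' := fun c x => by
        have h₁ := A₁.map_smul c ⟨x.1, x.2.1⟩
        have h₂ := A₂₁.map_smul c ⟨x.1.fst, x.2.2⟩
        rw [RingHom.id_apply, ← WithLp.toLp_smul, Prod.smul_mk, ← h₁, ← h₂]
        rfl }

/-- The operator on `H₁` obtained from the closure relation `h₂ = S A₂₁ h₁`: its domain is
`{h₁ ∈ dom A₂₁ | (h₁, S A₂₁ h₁) ∈ dom A₁}`, and it maps `h₁` to `A₁ (h₁, S A₂₁ h₁)`. -/
def AS (A₁ : WithLp 2 (H₁ × H₂) →ₗ.[ℂ] H₁) (A₂₁ : H₁ →ₗ.[ℂ] H₂) (S : H₂ →L[ℂ] H₂) :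
    H₁ →ₗ.[ℂ] H₁ where
  domain :=
    { carrier := {h | ∃ h₂₁ : h ∈ A₂₁.domain,
        WithLp.toLp 2 (h, S (A₂₁ ⟨h, h₂₁⟩)) ∈ A₁.domain}
      zero_mem' := ⟨A₂₁.domain.zero_mem, by
        have h₀ : A₂₁ ⟨0, A₂₁.domain.zero_mem⟩ = 0 := A₂₁.map_zero
        rw [h₀, _root_.map_zero]
        exact A₁.domain.zero_mem⟩
      add_mem' := by
        rintro x y ⟨hx, hx'⟩ ⟨hy, hy'⟩
        refine ⟨A₂₁.domain.add_mem hx hy, ?_⟩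
        have h := A₂₁.map_add ⟨x, hx⟩ ⟨y, hy⟩
        have h' : A₂₁ ⟨x + y, A₂₁.domain.add_mem hx hy⟩ = A₂₁ ⟨x, hx⟩ + A₂₁ ⟨y, hy⟩ := h
        rw [h', _root_.map_add]
        exact A₁.domain.add_mem hx' hy'
      smul_mem' := by
        rintro c x ⟨hx, hx'⟩
        refine ⟨A₂₁.domain.smul_mem c hx, ?_⟩
        have h' : A₂₁ ⟨c • x, A₂₁.domain.smul_mem c hx⟩ = c • A₂₁ ⟨x, hx⟩ :=
          A₂₁.map_smul c ⟨x, hx⟩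
        rw [h', _root_.map_smul]
        exact A₁.domain.smul_mem c hx' }
  toFun :=
    { toFun := fun x => A₁ ⟨WithLp.toLp 2 ((x : H₁), S (A₂₁ ⟨x, x.2.1⟩)), x.2.2⟩
      map_add' := fun x y => by
        rw [← A₁.map_add]
        congr 1
        have h : A₂₁ ⟨(x : H₁) + y, (x + y).2.1⟩ = A₂₁ ⟨x, x.2.1⟩ + A₂₁ ⟨y, y.2.1⟩ :=
          A₂₁.map_add ⟨x, x.2.1⟩ ⟨y, y.2.1⟩
        apply Subtype.ext
        change WithLp.toLp 2 ((x : H₁) + y, S (A₂₁ ⟨(x : H₁) + y, (x + y).2.1⟩)) = _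
        rw [h, _root_.map_add]
        rfl
      map_smul' := fun c x => by
        rw [RingHom.id_apply, ← A₁.map_smul]
        congr 1
        have h : A₂₁ ⟨c • (x : H₁), (c • x).2.1⟩ = c • A₂₁ ⟨x, x.2.1⟩ :=
          A₂₁.map_smul c ⟨x, x.2.1⟩
        apply Subtype.ext
        change WithLp.toLp 2 (c • (x : H₁), S (A₂₁ ⟨c • (x : H₁), (c • x).2.1⟩)) = _
        rw [h, _root_.map_smul]
        rfl }

/-- The splitting assumption: `dom A₁ = dom A₁₁ × dom A₁₂` and
`A₁ (h₁, h₂) = A₁₁ h₁ + A₁₂ h₂` on this domain. -/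
structure Splits (A₁ : WithLp 2 (H₁ × H₂) →ₗ.[ℂ] H₁) (A₁₁ : H₁ →ₗ.[ℂ] H₁)
    (A₁₂ : H₂ →ₗ.[ℂ] H₁) : Prop where
  mem_domain_iff : ∀ x : WithLp 2 (H₁ × H₂),
    x ∈ A₁.domain ↔ x.fst ∈ A₁₁.domain ∧ x.snd ∈ A₁₂.domain
  apply_eq : ∀ (x : A₁.domain) (h₁ : (x : WithLp 2 (H₁ × H₂)).fst ∈ A₁₁.domain)
    (h₂ : (x : WithLp 2 (H₁ × H₂)).snd ∈ A₁₂.domain),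
    A₁ x = A₁₁ ⟨(x : WithLp 2 (H₁ × H₂)).fst, h₁⟩ + A₁₂ ⟨(x : WithLp 2 (H₁ × H₂)).snd, h₂⟩

end Operators

end ClosureRelation

end

/-! With `A₁₁` given by a bounded operator `P`, the extended operator is the block matrix with rows
`(P, A₁₂)` and `(A₂₁, 0)`. By Lumer–Phillips, it generates a contraction semigroup exactly when it
is dissipative and `l - Aext` is onto for every `l > 0`. Sufficiency (`IsDissipative.generates`)
goes through Yosida approximation. Necessity is `IsGenerator.isDissipative` and
`IsGenerator.surjective`, the latter from a Laplace integral over `[0, 1]` and a Neumann series.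

If the block operator generates, dissipativity at `(a, c • b)` for all complex `c` forces `⟪A₁₂ b,
a⟫ = -⟪b, A₂₁ a⟫`, so `A₁₂ ≤ -A₂₁†`; surjectivity, with `P` perturbed away, leaves no room for a
proper extension (`IsBlockOperator.eq_neg_adjoint`).

Conversely, if `A₁₂ = -A₂₁†`, the off-diagonal terms cancel in the real part and the operator is
closed. A vector orthogonal to the range of `l - Aext` then lies in its domain, since `A₂₁` is its
own double adjoint, and dissipativity makes it zero (`IsBlockOperator.generates`). The description
of `A_S` is the splitting with `A₁₂ = -A₂₁†` inserted. -/

namespace ClosureRelation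

/-! ### Exponentials of bounded dissipative operators -/

section BoundedDissipative

variable {X : Type*} [NormedAddCommGroup X] [InnerProductSpace ℂ X] [CompleteSpace X]

theorem hasDerivAt_exp_smul_apply (B : X →L[ℂ] X) (x : X) (t : ℝ) :
    HasDerivAt (fun s : ℝ => NormedSpace.exp (s • B) x) (NormedSpace.exp (t • B) (B x)) t := by
  have h := hasDerivAt_exp_smul_const (𝕂 := ℝ) B t
  have h2 := ((ContinuousLinearMap.apply ℂ X x).restrictScalars ℝ).hasFDerivAt.comp_hasDerivAt t h
  exact h2

theorem exp_smul_apply_comm (B : X →L[ℂ] X) (x : X) (t : ℝ) :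
    NormedSpace.exp (t • B) (B x) = B (NormedSpace.exp (t • B) x) := by
  have h : Commute (NormedSpace.exp (t • B)) B :=
    (((Commute.refl B).smul_left t).exp_left)
  exact congrArg (fun T : X →L[ℂ] X => T x) h.eq

/-- The exponential of a bounded dissipative operator is contractive. -/
theorem norm_exp_smul_apply_le {B : X →L[ℂ] X} (hB : ∀ x, (inner ℂ (B x) x).re ≤ 0) {t : ℝ}
    (ht : 0 ≤ t) (x : X) : ‖NormedSpace.exp (t • B) x‖ ≤ ‖x‖ := by
  let _ : InnerProductSpace ℝ X := InnerProductSpace.rclikeToReal ℂ X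
  have hd : ∀ s : ℝ, HasDerivAt (fun s : ℝ => ‖NormedSpace.exp (s • B) x‖ ^ 2)
      (2 * inner ℝ (NormedSpace.exp (s • B) x) (NormedSpace.exp (s • B) (B x))) s := fun s =>
    (hasDerivAt_exp_smul_apply B x s).norm_sq
  -- The derivative of the squared norm is `2 Re ⟪B u, u⟫` at `u = exp (s B) x`.
  have hanti : Antitone (fun s : ℝ => ‖NormedSpace.exp (s • B) x‖ ^ 2) := by
    refine antitone_of_deriv_nonpos (fun s => (hd s).differentiableAt) fun s => ?_
    rw [(hd s).deriv, exp_smul_apply_comm, real_inner_comm]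
    have := hB (NormedSpace.exp (s • B) x)
    have h2 : inner ℝ (B (NormedSpace.exp (s • B) x)) (NormedSpace.exp (s • B) x)
      = (inner ℂ (B (NormedSpace.exp (s • B) x)) (NormedSpace.exp (s • B) x)).re := rfl
    linarith
  have h := hanti ht
  simp only [zero_smul, NormedSpace.exp_zero, one_apply_eq_self] at h
  exact (sq_le_sq₀ (norm_nonneg _) (norm_nonneg _)).1 h

theorem exp_add_apply_of_commute {B C : X →L[ℂ] X} (h : Commute B C) (x : X) :
    NormedSpace.exp (B + C) x = NormedSpace.exp B (NormedSpace.exp C x) := by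
  let _ : NormedAlgebra ℚ (X →L[ℂ] X) := NormedAlgebra.restrictScalars ℚ ℂ (X →L[ℂ] X)
  rw [NormedSpace.exp_add_of_commute h]
  rfl

theorem exp_add_smul_apply (B : X →L[ℂ] X) (s t : ℝ) (x : X) :
    NormedSpace.exp ((s + t) • B) x = NormedSpace.exp (s • B) (NormedSpace.exp (t • B) x) := by
  rw [add_smul, exp_add_apply_of_commute (((Commute.refl B).smul_left s).smul_right t)]

/-- Interpolate along `s ↦ exp (s B) exp ((t - s) C) x`, which commutation turns into `exp (t C) exp
(s (B - C)) x`. Its derivative is a product of contractions applied to `(B - C) x`. -/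
theorem norm_exp_sub_exp_apply_le {B C : X →L[ℂ] X} (hB : ∀ x, (inner ℂ (B x) x).re ≤ 0)
    (hC : ∀ x, (inner ℂ (C x) x).re ≤ 0) (hBC : Commute B C) {t : ℝ} (ht : 0 ≤ t) (x : X) :
    ‖NormedSpace.exp (t • B) x - NormedSpace.exp (t • C) x‖ ≤ t * ‖B x - C x‖ := by
  have key : ∀ s : ℝ, ∀ z : X, NormedSpace.exp (t • C) (NormedSpace.exp (s • (B - C)) z) =
      NormedSpace.exp (s • B) (NormedSpace.exp ((t - s) • C) z) := fun s z => by
    have h1 : Commute (t • C) (s • (B - C)) :=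
      ((hBC.symm.sub_right (Commute.refl C)).smul_left t).smul_right s
    have h2 : Commute (s • B) ((t - s) • C) := (hBC.smul_left s).smul_right _
    have h3 : t • C + s • (B - C) = s • B + (t - s) • C := by
      rw [smul_sub, sub_smul]; abel
    rw [← exp_add_apply_of_commute h1, h3, exp_add_apply_of_commute h2]
  have hd : ∀ s ∈ Set.Icc 0 t, HasDerivWithinAt
      (fun s : ℝ => NormedSpace.exp (t • C) (NormedSpace.exp (s • (B - C)) x))
      (NormedSpace.exp (t • C) (NormedSpace.exp (s • (B - C)) ((B - C) x))) (Set.Icc 0 t) s :=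
    fun s _ => (((NormedSpace.exp (t • C)).restrictScalars ℝ).hasFDerivAt.comp_hasDerivAt s
      (hasDerivAt_exp_smul_apply (B - C) x s)).hasDerivWithinAt
  have hb : ∀ s ∈ Set.Ico 0 t,
      ‖NormedSpace.exp (t • C) (NormedSpace.exp (s • (B - C)) ((B - C) x))‖ ≤ ‖B x - C x‖ := by
    intro s hs
    rw [key]
    exact (norm_exp_smul_apply_le hB hs.1 _).trans
      (norm_exp_smul_apply_le hC (sub_nonneg.2 hs.2.le) _)
  have h := norm_image_sub_le_of_norm_deriv_le_segment' hd hb t ⟨ht, le_rfl⟩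
  rw [key, key] at h
  simpa [mul_comm] using h

theorem norm_exp_sub_self_le {B : X →L[ℂ] X} (hB : ∀ x, (inner ℂ (B x) x).re ≤ 0) {t : ℝ}
    (ht : 0 ≤ t) (x : X) : ‖NormedSpace.exp (t • B) x - x‖ ≤ t * ‖B x‖ := by
  simpa using norm_exp_sub_exp_apply_le (C := 0) hB (by simp) (Commute.zero_right B) ht x

/-- First-order Taylor bound, meant for `B = B n` and `y = A x`. As `A x` may lie outside `dom A`,
`B n (A x)` is not controlled; a nearby `z` in `dom A` replaces it. -/
theorem norm_exp_sub_self_sub_le {B : X →L[ℂ] X} (hB : ∀ x, (inner ℂ (B x) x).re ≤ 0) {t : ℝ}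
    (ht : 0 ≤ t) (x y z : X) :
    ‖NormedSpace.exp (t • B) x - x - t • y‖ ≤ t * (‖B x - y‖ + (2 * ‖y - z‖ + t * ‖B z‖)) := by
  have hd : ∀ s ∈ Set.Icc 0 t, HasDerivWithinAt
      (fun s : ℝ => NormedSpace.exp (s • B) x - s • y)
      (NormedSpace.exp (s • B) (B x) - (1 : ℝ) • y) (Set.Icc 0 t) s :=
    fun s _ => ((hasDerivAt_exp_smul_apply B x s).sub
      ((hasDerivAt_id s).smul_const y)).hasDerivWithinAt
  have hb : ∀ s ∈ Set.Ico 0 t,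
      ‖NormedSpace.exp (s • B) (B x) - (1 : ℝ) • y‖ ≤
        ‖B x - y‖ + (2 * ‖y - z‖ + t * ‖B z‖) := by
    intro s hs
    have e : NormedSpace.exp (s • B) (B x) - (1 : ℝ) • y =
        NormedSpace.exp (s • B) (B x - y) + (NormedSpace.exp (s • B) (y - z) +
          ((NormedSpace.exp (s • B) z - z) - (y - z))) := by
      rw [map_sub, map_sub, one_smul]; abel
    rw [e]
    have h1 := norm_exp_smul_apply_le hB hs.1 (B x - y)
    have h2 := norm_exp_smul_apply_le hB hs.1 (y - z)
    have h3 := norm_exp_sub_self_le hB hs.1 z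
    have h4 : s * ‖B z‖ ≤ t * ‖B z‖ := by gcongr; exact hs.2.le
    have h5 := norm_add_le (NormedSpace.exp (s • B) (B x - y)) (NormedSpace.exp (s • B) (y - z) +
          ((NormedSpace.exp (s • B) z - z) - (y - z)))
    have h6 := norm_add_le (NormedSpace.exp (s • B) (y - z))
          ((NormedSpace.exp (s • B) z - z) - (y - z))
    have h7 := norm_sub_le (NormedSpace.exp (s • B) z - z) (y - z)
    linarith
  have h := norm_image_sub_le_of_norm_deriv_le_segment' hd hb t ⟨ht, le_rfl⟩
  have e : NormedSpace.exp (t • B) x - x - t • y =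
      NormedSpace.exp (t • B) x - t • y - (NormedSpace.exp ((0 : ℝ) • B) x - (0 : ℝ) • y) := by
    simp; abel
  rw [e, mul_comm t]
  simpa using h

end BoundedDissipative

/-! ### Strong limits of semigroups -/

section LimitSemigroup

variable {X : Type*} [NormedAddCommGroup X] [InnerProductSpace ℂ X] [CompleteSpace X]

/-- A pointwise limit of linear contractions along a sequence that is pointwise Cauchy. -/
theorem exists_contraction_of_cauchySeq {T : ℕ → X →L[ℂ] X} (hT : ∀ n x, ‖T n x‖ ≤ ‖x‖)
    (hc : ∀ x, CauchySeq fun n => T n x) :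
    ∃ S : X →L[ℂ] X, (∀ x, ‖S x‖ ≤ ‖x‖) ∧ ∀ x, Tendsto (fun n => T n x) atTop (𝓝 (S x)) := by
  choose f hf using fun x => cauchySeq_tendsto_of_complete (hc x)
  have hb : ∀ x, ‖f x‖ ≤ ‖x‖ := fun x => le_of_tendsto (hf x).norm (.of_forall fun n => hT n x)
  let g : X →ₗ[ℂ] X :=
    { toFun := f
      map_add' := fun x y => tendsto_nhds_unique (hf (x + y)) (by
        simpa only [map_add] using (hf x).add (hf y))
      map_smul' := fun c x => tendsto_nhds_unique (hf (c • x)) (by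
        simpa only [map_smul, RingHom.id_apply] using (hf x).const_smul c) }
  exact ⟨g.mkContinuous 1 fun x => (hb x).trans_eq (one_mul _).symm, hb, hf⟩

omit [CompleteSpace X] in
theorem cauchySeq_of_dense {T : ℕ → X →L[ℂ] X} (hT : ∀ n x, ‖T n x‖ ≤ ‖x‖) {D : Set X}
    (hD : Dense D) (hc : ∀ x ∈ D, CauchySeq fun n => T n x) (x : X) :
    CauchySeq fun n => T n x := by
  rw [Metric.cauchySeq_iff]
  intro ε hε
  obtain ⟨z, hzD, hz⟩ := hD.exists_dist_lt x (show 0 < ε / 3 by positivity)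
  obtain ⟨N, hN⟩ := Metric.cauchySeq_iff.1 (hc z hzD) (ε / 3) (by positivity)
  refine ⟨N, fun m hm n hn => ?_⟩
  have h1 : dist (T m x) (T m z) ≤ dist x z := by
    rw [dist_eq_norm, dist_eq_norm, ← map_sub]; exact hT m _
  have h2 : dist (T n z) (T n x) ≤ dist x z := by
    rw [dist_comm x, dist_eq_norm, dist_eq_norm, ← map_sub]; exact hT n _
  have h3 := hN m hm n hn
  have h4 := dist_triangle4 (T m x) (T m z) (T n z) (T n x)
  linarith

/-- If commuting bounded dissipative operators `B n` converge pointwise to the densely defined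
operator `A` on its domain, then the semigroups `exp (t B n)` converge to a contraction semigroup,
and `A` is a restriction of its generator. -/
theorem exists_contractionSemigroup_of_tendsto {A : X →ₗ.[ℂ] X} (hA : Dense (A.domain : Set X))
    {B : ℕ → X →L[ℂ] X} (hB : ∀ n x, (inner ℂ (B n x) x).re ≤ 0)
    (hcomm : ∀ m n, Commute (B m) (B n))
    (hlim : ∀ x : A.domain, Tendsto (fun n => B n x) atTop (𝓝 (A x))) :
    ∃ T : ℝ≥0 → X →L[ℂ] X, IsContractionSemigroup T ∧ ∀ x : A.domain,
      Tendsto (fun t : ℝ≥0 => (((t : ℝ) : ℂ))⁻¹ • (T t x - x)) (𝓝[>] 0) (𝓝 (A x)) := by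
  have hE : ∀ (t : ℝ≥0) n x, ‖NormedSpace.exp ((t : ℝ) • B n) x‖ ≤ ‖x‖ := fun t n x =>
    norm_exp_smul_apply_le (hB n) t.2 x
  have hcau : ∀ t : ℝ≥0, ∀ x, CauchySeq fun n => NormedSpace.exp ((t : ℝ) • B n) x := fun t =>
    cauchySeq_of_dense (hE t) hA fun x hx => by
      have h1 := (hlim ⟨x, hx⟩).cauchySeq
      rw [Metric.cauchySeq_iff] at h1 ⊢
      intro ε hε
      -- Dividing by `t + 1` rather than `t` covers `t = 0`.
      obtain ⟨N, hN⟩ := h1 (ε / (t + 1)) (by positivity)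
      refine ⟨N, fun m hm n hn => ?_⟩
      have h2 := hN m hm n hn
      have h3 := norm_exp_sub_exp_apply_le (hB m) (hB n) (hcomm m n) t.2 x
      rw [dist_eq_norm] at h2 ⊢
      rw [lt_div_iff₀ (by positivity)] at h2
      refine h3.trans_lt (lt_of_le_of_lt ?_ h2)
      rw [mul_comm]
      gcongr
      exact (le_add_of_nonneg_right zero_le_one : (t : ℝ) ≤ t + 1)
  choose T hTn hT using fun t : ℝ≥0 => exists_contraction_of_cauchySeq (hE t) (hcau t)
  have hT0 : T 0 = ContinuousLinearMap.id ℂ X := by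
    ext x
    refine tendsto_nhds_unique (hT 0 x) ?_
    simp
  have hTadd : ∀ s t x, T (s + t) x = T s (T t x) := fun s t x => by
    refine tendsto_nhds_unique (hT (s + t) x) ?_
    -- The argument of `exp (s B n)` moves with `n`; contractivity makes the error vanish.
    have h1 : ∀ n, NormedSpace.exp (((s + t : ℝ≥0) : ℝ) • B n) x =
        NormedSpace.exp ((s : ℝ) • B n) (NormedSpace.exp ((t : ℝ) • B n) x - T t x) +
          NormedSpace.exp ((s : ℝ) • B n) (T t x) := fun n => by
      rw [NNReal.coe_add, exp_add_smul_apply, map_sub]; abel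
    simp only [h1]
    have h2 : Tendsto (fun n => NormedSpace.exp ((t : ℝ) • B n) x - T t x) atTop (𝓝 0) := by
      simpa using (hT t x).sub_const (T t x)
    have h3 := squeeze_zero_norm (fun n => hE s n _) (tendsto_zero_iff_norm_tendsto_zero.1 h2)
    simpa using h3.add (hT s (T t x))
  have hsmall : ∀ (t : ℝ≥0) (x : A.domain), ‖T t x - x‖ ≤ t * ‖A x‖ := fun t x =>
    le_of_tendsto_of_tendsto ((hT t x).sub_const _).norm ((hlim x).norm.const_mul _)
      (.of_forall fun n => norm_exp_sub_self_le (hB n) t.2 x)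
  have htaylor : ∀ (t : ℝ≥0) (x z : A.domain),
      ‖T t x - x - (t : ℝ) • A x‖ ≤ t * (2 * ‖A x - z‖ + t * ‖A z‖) := fun t x z => by
    have h1 : Tendsto (fun n => (t : ℝ) * (‖B n x - A x‖ + (2 * ‖A x - z‖ + t * ‖B n z‖))) atTop
        (𝓝 (t * (0 + (2 * ‖A x - z‖ + t * ‖A z‖)))) := by
      refine Tendsto.const_mul _ (Tendsto.add ?_ (((hlim z).norm.const_mul _).const_add _))
      exact tendsto_iff_norm_sub_tendsto_zero.1 (hlim x)
    rw [zero_add] at h1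
    exact le_of_tendsto_of_tendsto (((hT t x).sub_const _).sub_const _).norm h1
      (.of_forall fun n => norm_exp_sub_self_sub_le (hB n) t.2 x (A x) z)
  have hdiff : ∀ (s t : ℝ≥0) (x : A.domain), s ≤ t → ‖T t x - T s x‖ ≤ (t - s) * ‖A x‖ := by
    intro s t x hst
    obtain ⟨h, rfl⟩ := exists_add_of_le hst
    rw [hTadd, ← map_sub]
    refine (hTn s _).trans ((hsmall h x).trans_eq ?_)
    simp
  have hdist : ∀ (s t : ℝ≥0) (x : A.domain), dist (T t x) (T s x) ≤ ‖A x‖ * dist t s := by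
    intro s t x
    rw [NNReal.dist_eq, mul_comm]
    rcases le_total s t with h | h
    · rw [dist_eq_norm, abs_of_nonneg (sub_nonneg.2 (NNReal.coe_le_coe.2 h))]
      exact hdiff s t x h
    · rw [dist_comm, dist_eq_norm, abs_sub_comm, abs_of_nonneg (sub_nonneg.2 (NNReal.coe_le_coe.2 h))]
      exact hdiff t s x h
  have hcont : ∀ x, Continuous fun t : ℝ≥0 => T t x := fun x => by
    -- Orbits from the dense domain are Lipschitz, and contractivity makes the approximation uniform
    -- in `t`.
    refine continuous_of_uniform_approx_of_continuous fun u hu => ?_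
    obtain ⟨ε, hε, hεu⟩ := Metric.mem_uniformity_dist.1 hu
    obtain ⟨z, hzD, hz⟩ := hA.exists_dist_lt x hε
    refine ⟨fun t => T t z, ?_, fun t => hεu ?_⟩
    · exact (LipschitzWith.of_dist_le_mul (K := ‖A ⟨z, hzD⟩‖₊) fun t s =>
        hdist s t ⟨z, hzD⟩).continuous
    · refine lt_of_le_of_lt ?_ hz
      rw [dist_eq_norm, dist_eq_norm, ← map_sub]
      exact hTn t _
  refine ⟨T, ⟨hT0, fun s t => ContinuousLinearMap.ext fun x => hTadd s t x, hcont, fun t =>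
    (T t).opNorm_le_bound zero_le_one fun x => by simpa using hTn t x⟩, fun x => ?_⟩
  rw [Metric.tendsto_nhdsWithin_nhds]
  intro ε hε
  obtain ⟨z, hzD, hz⟩ := hA.exists_dist_lt (A x) (show 0 < ε / 4 by positivity)
  -- The bound `2 ‖A x - z‖ + t ‖A z‖` is less than `ε / 2 + ε / 2`; the `+ 1` avoids a zero
  -- denominator.
  refine ⟨ε / (2 * (‖A ⟨z, hzD⟩‖ + 1)), by positivity, fun t ht htd => ?_⟩
  have ht0 : (0 : ℝ) < t := ht
  have hne : ((t : ℝ) : ℂ) ≠ 0 := by exact_mod_cast ht0.ne'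
  rw [NNReal.dist_eq, NNReal.coe_zero, sub_zero, abs_of_pos ht0, lt_div_iff₀ (by positivity)] at htd
  have e : (((t : ℝ) : ℂ))⁻¹ • (T t x - x) - A x =
      (((t : ℝ) : ℂ))⁻¹ • (T t x - x - (t : ℝ) • A x) := by
    rw [smul_sub _ (T t x - x), ← Complex.coe_smul, inv_smul_smul₀ hne]
  rw [dist_eq_norm, e, norm_smul, norm_inv, Complex.norm_real, Real.norm_of_nonneg ht0.le,
    inv_mul_lt_iff₀ ht0]
  refine (htaylor t x ⟨z, hzD⟩).trans_lt ?_
  rw [dist_eq_norm] at hz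
  gcongr
  change 2 * ‖A x - z‖ + _ < _
  nlinarith [norm_nonneg (A ⟨z, hzD⟩)]

end LimitSemigroup

/-! ### Resolvents of dissipative operators and Lumer–Phillips, sufficiency -/

section Dissipative

variable {X : Type*} [NormedAddCommGroup X] [InnerProductSpace ℂ X]

theorem IsDissipative.mul_norm_sq_le {A : X →ₗ.[ℂ] X} (hA : IsDissipative A) (l : ℝ)
    (x : A.domain) : l * ‖(x : X)‖ ^ 2 ≤ (inner ℂ ((l : ℂ) • (x : X) - A x) (x : X)).re := by
  have h := hA x
  have h2 : (inner ℂ (x : X) (x : X)).re = ‖(x : X)‖ ^ 2 := inner_self_eq_norm_sq (𝕜 := ℂ) (x : X)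
  rw [inner_sub_left, inner_smul_left, Complex.conj_ofReal, Complex.sub_re, Complex.re_ofReal_mul,
    h2]
  linarith

theorem IsDissipative.mul_norm_le {A : X →ₗ.[ℂ] X} (hA : IsDissipative A) (l : ℝ)
    (x : A.domain) : l * ‖(x : X)‖ ≤ ‖(l : ℂ) • (x : X) - A x‖ := by
  rcases (norm_nonneg (x : X)).eq_or_lt with h0 | h0
  · rw [← h0, mul_zero]; exact norm_nonneg _
  · have h1 := hA.mul_norm_sq_le l x
    have h2 := (Complex.re_le_norm _).trans (norm_inner_le_norm (𝕜 := ℂ) ((l : ℂ) • (x : X) - A x) x)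
    refine le_of_mul_le_mul_right ?_ h0
    calc l * ‖(x : X)‖ * ‖(x : X)‖ = l * ‖(x : X)‖ ^ 2 := by ring
      _ ≤ _ := h1.trans h2

/-- A dissipative operator `A` with `l - A` surjective for some `l > 0` is densely defined. -/
theorem IsDissipative.dense_domain [CompleteSpace X] {A : X →ₗ.[ℂ] X} (hA : IsDissipative A)
    {l : ℝ} (hl : 0 < l) (hr : ∀ y : X, ∃ x : A.domain, (l : ℂ) • (x : X) - A x = y) :
    Dense (A.domain : Set X) := by
  rw [Submodule.dense_iff_topologicalClosure_eq_top, Submodule.topologicalClosure_eq_top_iff,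
    Submodule.eq_bot_iff]
  intro y hy
  -- Write `y = l x - A x`; orthogonality to `x` itself gives `l ‖x‖² ≤ 0`.
  obtain ⟨x, rfl⟩ := hr y
  have h1 := hA.mul_norm_sq_le l x
  rw [(Submodule.mem_orthogonal' _ _).1 hy x x.2, Complex.zero_re] at h1
  have h2 : x = 0 := by
    have : ‖(x : X)‖ ^ 2 ≤ 0 := by
      by_contra h
      have := mul_pos hl (not_le.1 h)
      linarith
    exact Subtype.ext (norm_eq_zero.1 (pow_eq_zero_iff two_ne_zero |>.1 (this.antisymm (by positivity))))
  rw [h2]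
  simp

/-- The resolvent of a maximal dissipative operator. -/
theorem IsDissipative.exists_resolvent {A : X →ₗ.[ℂ] X} (hA : IsDissipative A)
    {l : ℝ} (hl : 0 < l) (hr : ∀ y : X, ∃ x : A.domain, (l : ℂ) • (x : X) - A x = y) :
    ∃ R : X →L[ℂ] X, (∀ y, l * ‖R y‖ ≤ ‖y‖) ∧
      (∀ y, ∃ x : A.domain, (x : X) = R y ∧ (l : ℂ) • (x : X) - A x = y) ∧
      ∀ x : A.domain, R ((l : ℂ) • (x : X) - A x) = x := by
  choose f hf using hr
  have hinj : ∀ u v : A.domain, (l : ℂ) • (u : X) - A u = (l : ℂ) • (v : X) - A v → u = v := by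
    intro u v huv
    have h1 := hA.mul_norm_le l (u - v)
    have h2 : (l : ℂ) • ((u - v : A.domain) : X) - A (u - v) = 0 := by
      rw [A.map_sub, Submodule.coe_sub, smul_sub, ← sub_eq_zero.2 huv]
      abel
    rw [h2, norm_zero] at h1
    have h3 : ‖((u - v : A.domain) : X)‖ = 0 := by
      by_contra h
      have := mul_pos hl (lt_of_le_of_ne (norm_nonneg _) (Ne.symm h))
      linarith
    exact sub_eq_zero.1 (Subtype.ext (norm_eq_zero.1 h3))
  let g : X →ₗ[ℂ] A.domain :=
    { toFun := f
      map_add' := fun x y => hinj _ _ (by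
        rw [hf, A.map_add, Submodule.coe_add, smul_add, add_sub_add_comm, hf, hf])
      map_smul' := fun c x => hinj _ _ (by
        rw [hf, RingHom.id_apply, A.map_smul, Submodule.coe_smul, smul_comm, ← smul_sub, hf]) }
  have hb : ∀ y, l * ‖(f y : X)‖ ≤ ‖y‖ := fun y => by
    simpa only [hf] using hA.mul_norm_le l (f y)
  refine ⟨(A.domain.subtype.comp g).mkContinuous l⁻¹ fun y => ?_, hb, fun y => ⟨f y, rfl, hf y⟩,
    fun x => congrArg Subtype.val (hinj _ _ (hf _))⟩
  rw [inv_mul_eq_div, le_div_iff₀ hl, mul_comm]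
  exact hb y

/-- A dissipative operator `A` with `l - A` surjective for some `l > 0` is closed. -/
theorem IsDissipative.isClosed {A : X →ₗ.[ℂ] X} (hA : IsDissipative A)
    {l : ℝ} (hl : 0 < l) (hr : ∀ y : X, ∃ x : A.domain, (l : ℂ) • (x : X) - A x = y) :
    A.IsClosed := by
  obtain ⟨R, -, hR, hR'⟩ := hA.exists_resolvent hl hr
  -- The resolvent exhibits the graph as the equalizer of two continuous maps.
  have h : (A.graph : Set (X × X)) = {p | R ((l : ℂ) • p.1 - p.2) = p.1} := by
    ext ⟨x, y⟩
    rw [SetLike.mem_coe, LinearPMap.mem_graph_iff]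
    constructor
    · rintro ⟨z, rfl, rfl⟩
      exact hR' z
    · intro hxy
      obtain ⟨z, hz, hz'⟩ := hR ((l : ℂ) • x - y)
      have hzx : (z : X) = x := hz.trans hxy
      refine ⟨z, hzx, ?_⟩
      rw [hzx] at hz'
      exact sub_right_injective hz'
  rw [LinearPMap.IsClosed, h]
  exact isClosed_eq (by fun_prop) continuous_fst

/-- The resolvent identity, from applying `R` to `l x - A x` with `x = S y`. -/
theorem resolvent_sub_resolvent {A : X →ₗ.[ℂ] X} {R S : X →L[ℂ] X} {l m : ℂ}
    (hR' : ∀ x : A.domain, R (l • (x : X) - A x) = x)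
    (hS : ∀ y, ∃ x : A.domain, (x : X) = S y ∧ m • (x : X) - A x = y) (y : X) :
    R y - S y = (m - l) • R (S y) := by
  obtain ⟨x, hx, hxy⟩ := hS y
  have h : l • (x : X) - A x = y - (m - l) • S y := by
    rw [← hx, ← hxy, sub_smul]
    abel
  have h2 := hR' x
  rw [h, map_sub, map_smul, hx] at h2
  rw [sub_eq_iff_eq_add, ← sub_eq_iff_eq_add', h2]

/-- For `l ≠ m`, exchanging the roles in the resolvent identity gives `R S = S R` after cancelling
`m - l`. For `l = m` the identity says `R = S`. -/
theorem commute_resolvent {A : X →ₗ.[ℂ] X} {R S : X →L[ℂ] X} {l m : ℂ}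
    (hR : ∀ y, ∃ x : A.domain, (x : X) = R y ∧ l • (x : X) - A x = y)
    (hR' : ∀ x : A.domain, R (l • (x : X) - A x) = x)
    (hS : ∀ y, ∃ x : A.domain, (x : X) = S y ∧ m • (x : X) - A x = y)
    (hS' : ∀ x : A.domain, S (m • (x : X) - A x) = x) : Commute R S := by
  have h1 := resolvent_sub_resolvent hR' hS
  have h2 := resolvent_sub_resolvent hS' hR
  by_cases hlm : l = m
  · subst hlm
    have : R = S := ContinuousLinearMap.ext fun y => by
      have := h1 y
      rwa [sub_self, zero_smul, sub_eq_zero] at this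
    rw [this]
  · refine ContinuousLinearMap.ext fun y => ?_
    have h3 : (m - l) • R (S y) = (m - l) • S (R y) := by
      rw [← h1, ← neg_sub (S y), h2, ← neg_smul, neg_sub]
    exact smul_right_injective X (sub_ne_zero.2 (Ne.symm hlm)) h3

/-- Difference quotients of a contraction semigroup have nonpositive real part. -/
theorem IsContractionSemigroup.inner_re_nonpos {T : ℝ≥0 → X →L[ℂ] X}
    (hT : IsContractionSemigroup T) {x y : X}
    (h : Tendsto (fun t : ℝ≥0 => (((t : ℝ) : ℂ))⁻¹ • (T t x - x)) (𝓝[>] 0) (𝓝 y)) :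
    (inner ℂ y x).re ≤ 0 := by
  have h1 := (Complex.continuous_re.tendsto _).comp (h.inner (tendsto_const_nhds (x := x)) (𝕜 := ℂ))
  refine le_of_tendsto h1 (.of_forall fun t => ?_)
  have h2 : (inner ℂ (T t x - x) x).re ≤ 0 := by
    have h3 := (Complex.re_le_norm _).trans (norm_inner_le_norm (𝕜 := ℂ) (T t x) x)
    have h4 : ‖T t x‖ ≤ ‖x‖ := by
      simpa using (T t).le_of_opNorm_le (hT.contractive t) x
    have h5 : (inner ℂ x x).re = ‖x‖ ^ 2 := inner_self_eq_norm_sq (𝕜 := ℂ) x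
    rw [inner_sub_left, Complex.sub_re, h5]
    nlinarith [norm_nonneg x]
  have e : (inner ℂ ((((t : ℝ) : ℂ))⁻¹ • (T t x - x)) x).re
      = (t : ℝ)⁻¹ * (inner ℂ (T t x - x) x).re := by
    rw [inner_smul_left, ← Complex.ofReal_inv, Complex.conj_ofReal, Complex.re_ofReal_mul]
  exact e.trans_le (mul_nonpos_of_nonneg_of_nonpos (by positivity) h2)

/-- The Lumer–Phillips theorem in a Hilbert space, sufficiency. -/
theorem IsDissipative.generates [CompleteSpace X] {A : X →ₗ.[ℂ] X} (hA : IsDissipative A)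
    (hr : ∀ l : ℝ, 0 < l → ∀ y : X, ∃ x : A.domain, (l : ℂ) • (x : X) - A x = y) :
    GeneratesContractionSemigroup A := by
  have hD := hA.dense_domain one_pos (hr 1 one_pos)
  choose R hRb hR hR' using fun n : ℕ => hA.exists_resolvent (l := n + 1) (by positivity)
    (hr (n + 1) (by positivity))
  -- The parameters are `n + 1`, positive also at `n = 0`, and the `B n` below are the Yosida
  -- approximations.
  set c : ℕ → ℂ := fun n => (((n : ℝ) + 1 : ℝ) : ℂ) with hc
  have hcn : ∀ n, ‖c n‖ = n + 1 := fun n => by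
    rw [hc, Complex.norm_real, Real.norm_of_nonneg (by positivity)]
  let B : ℕ → X →L[ℂ] X := fun n => c n • (c n • R n - 1)
  have hJb : ∀ n x, ‖(c n • R n) x‖ ≤ ‖x‖ := fun n x => by
    change ‖c n • R n x‖ ≤ _
    rw [norm_smul, hcn]; exact hRb n x
  have hBA : ∀ n (x : A.domain), B n x = (c n • R n) (A x) := fun n x => by
    have := hR' n x
    rw [map_sub, map_smul] at this
    change c n • (c n • R n x - x) = c n • R n (A x)
    congr 1
    rw [sub_eq_iff_eq_add, ← sub_eq_iff_eq_add']
    exact this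
  -- On `dom A` one has `c n R n z - z = R n (A z)`, of norm at most `‖A z‖ / (n + 1)`; density and
  -- contractivity do the rest.
  have hJ : ∀ x, Tendsto (fun n => (c n • R n) x) atTop (𝓝 x) := by
    intro x
    rw [Metric.tendsto_atTop]
    intro ε hε
    obtain ⟨z, hzD, hz⟩ := hD.exists_dist_lt x (show 0 < ε / 3 by positivity)
    obtain ⟨N, hN⟩ := exists_nat_gt (‖A ⟨z, hzD⟩‖ / (ε / 3))
    refine ⟨N, fun n hn => ?_⟩
    have h1 : dist ((c n • R n) x) ((c n • R n) z) ≤ dist x z := by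
      rw [dist_eq_norm, dist_eq_norm, ← map_sub]; exact hJb n _
    have h2 : dist ((c n • R n) z) z < ε / 3 := by
      have h3 := hR' n ⟨z, hzD⟩
      rw [map_sub, map_smul, sub_eq_iff_eq_add, ← sub_eq_iff_eq_add'] at h3
      rw [dist_eq_norm]
      change ‖c n • R n z - z‖ < _
      rw [h3]
      have h4 := hRb n (A ⟨z, hzD⟩)
      rw [div_lt_iff₀ (by positivity)] at hN
      have h5 : (N : ℝ) ≤ n := by exact_mod_cast hn
      have h6 : (0 : ℝ) < (n : ℝ) + 1 := by positivity
      refine lt_of_mul_lt_mul_left (h4.trans_lt (hN.trans_le ?_)) h6.le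
      gcongr
      linarith
    have h7 := dist_triangle4 ((c n • R n) x) ((c n • R n) z) z x
    rw [dist_comm z x] at h7
    linarith
  have hBd : ∀ n x, (inner ℂ (B n x) x).re ≤ 0 := fun n x => by
    change (inner ℂ (c n • ((c n • R n) x - x)) x).re ≤ 0
    rw [inner_smul_left, hc, Complex.conj_ofReal, Complex.re_ofReal_mul]
    refine mul_nonpos_of_nonneg_of_nonpos (by positivity) ?_
    have h3 := (Complex.re_le_norm _).trans (norm_inner_le_norm (𝕜 := ℂ) ((c n • R n) x) x)
    have h5 : (inner ℂ x x).re = ‖x‖ ^ 2 := inner_self_eq_norm_sq (𝕜 := ℂ) x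
    rw [inner_sub_left, Complex.sub_re, h5]
    nlinarith [norm_nonneg x, hJb n x]
  have hBc : ∀ m n, Commute (B m) (B n) := fun m n => by
    have h := commute_resolvent (hR m) (hR' m) (hR n) (hR' n)
    have h1 : Commute (c m • R m - 1) (c n • R n - 1) :=
      (((h.smul_left _).smul_right _).sub_left (Commute.one_left _)).sub_right
        (Commute.one_right _)
    exact (h1.smul_left _).smul_right _
  obtain ⟨T, hT, hTA⟩ := exists_contractionSemigroup_of_tendsto hD hBd hBc fun x => by
    simp only [hBA]; exact hJ (A x)
  refine ⟨T, hT, fun x y => ⟨fun h => ?_, fun h => ?_⟩⟩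
  · obtain ⟨z, rfl, rfl⟩ := A.mem_graph_iff.1 h
    exact hTA z
  -- The generator has no larger domain: if `z - A z = x - y`, then `x - z` is an eigenvector of the
  -- generator for the eigenvalue `1`, or zero; dissipativity leaves only zero.
  · obtain ⟨z, hz⟩ := hr 1 one_pos (x - y)
    rw [Complex.ofReal_one, one_smul] at hz
    have h1 : Tendsto (fun t : ℝ≥0 => (((t : ℝ) : ℂ))⁻¹ • (T t (x - z) - (x - z))) (𝓝[>] 0)
        (𝓝 (x - z)) := by
      have h2 := h.sub (hTA z)
      have e : y - A z = x - z := by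
        rw [sub_eq_sub_iff_add_eq_add, add_comm, sub_eq_sub_iff_add_eq_add.1 hz]
      rw [e] at h2
      refine h2.congr fun t => ?_
      rw [← smul_sub, map_sub]
      congr 1
      abel
    have h3 := hT.inner_re_nonpos h1
    have h5 : (inner ℂ (x - (z : X)) (x - z)).re = ‖x - z‖ ^ 2 := inner_self_eq_norm_sq (𝕜 := ℂ) _
    rw [h5] at h3
    have h6 : x = z := sub_eq_zero.1 (norm_eq_zero.1
      ((pow_eq_zero_iff two_ne_zero).1 (h3.antisymm (by positivity))))
    subst h6
    exact A.mem_graph_iff.2 ⟨z, rfl, sub_right_injective hz⟩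

end Dissipative

/-! ### Lumer–Phillips, necessity, and range conditions -/

section Dissipative

variable {X : Type*} [NormedAddCommGroup X] [InnerProductSpace ℂ X]

/-- The generator of a contraction semigroup is dissipative. -/
theorem IsGenerator.isDissipative {A : X →ₗ.[ℂ] X} {T : ℝ≥0 → X →L[ℂ] X}
    (hA : IsGenerator A T) (hT : IsContractionSemigroup T) : IsDissipative A := fun x =>
  hT.inner_re_nonpos ((hA x (A x)).1 (A.mem_graph x))

/-- The integral of a rescaled orbit lies in the domain of the generator. -/
theorem IsGenerator.exists_sub_eq [CompleteSpace X] {A : X →ₗ.[ℂ] X} {T : ℝ≥0 → X →L[ℂ] X}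
    (hA : IsGenerator A T) (hT : IsContractionSemigroup T) (l : ℝ) (y : X) :
    ∃ x : A.domain, (l : ℂ) • (x : X) - A x = y - Real.exp (-l) • T 1 y := by
  -- The witness is `F 1`, the integral of `f` over `[0, 1]`. Extending the orbit by `T 0` to
  -- negative times keeps `f` continuous on `ℝ`, so `F` has two-sided derivatives.
  set f : ℝ → X := fun s => Real.exp (-(l * s)) • T s.toNNReal y with hf
  have hfc : Continuous f := by
    have := (hT.continuous_orbit y).comp continuous_real_toNNReal
    exact (show Continuous fun s : ℝ => Real.exp (-(l * s)) by fun_prop).smul this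
  have hTf : ∀ h s : ℝ, 0 ≤ h → 0 ≤ s → T h.toNNReal (f s) = Real.exp (l * h) • f (s + h) := by
    intro h s hh hs
    simp only [hf]
    rw [add_comm s h, Real.toNNReal_add hh hs, hT.map_add, ← Complex.coe_smul, map_smul,
      Complex.coe_smul, smul_smul, ← Real.exp_add]
    congr 2
    ring
  set F : ℝ → X := fun t => ∫ s in (0 : ℝ)..t, f s with hF
  have hFd : ∀ t, HasDerivAt F (f t) t := fun t => hfc.integral_hasStrictDerivAt 0 t |>.hasDerivAt
  have hTu : ∀ h : ℝ, 0 ≤ h → T h.toNNReal (F 1) = Real.exp (l * h) • (F (1 + h) - F h) := by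
    intro h hh
    simp only [hF]
    rw [intervalIntegral.integral_interval_sub_left (hfc.intervalIntegrable _ _)
      (hfc.intervalIntegrable _ _), ← ContinuousLinearMap.intervalIntegral_comp_comm _
      (hfc.intervalIntegrable _ _), intervalIntegral.integral_congr (g := fun s =>
        Real.exp (l * h) • f (s + h)), intervalIntegral.integral_smul,
      intervalIntegral.integral_comp_add_right, zero_add]
    intro s hs
    rw [Set.uIcc_of_le zero_le_one] at hs
    exact hTf h s hh hs.1
  have hG : HasDerivAt (fun h : ℝ => Real.exp (l * h) • (F (1 + h) - F h))
      (l • F 1 + (f 1 - y)) 0 := by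
    have h1 : HasDerivAt (fun h : ℝ => Real.exp (l * h)) l 0 := by
      simpa using ((hasDerivAt_id (0 : ℝ)).const_mul l).exp
    have h2 : HasDerivAt (fun h : ℝ => F (1 + h) - F h) (f 1 - f 0) 0 := by
      refine HasDerivAt.sub ?_ (hFd 0)
      refine HasDerivAt.comp_const_add 1 0 ?_
      rw [add_zero]
      exact hFd 1
    have h3 := h1.smul h2
    have hF0 : F 0 = 0 := intervalIntegral.integral_same
    have hf0 : f 0 = y := by simp [hf, hT.map_zero]
    simp only [mul_zero, Real.exp_zero, one_smul, add_zero, hF0, sub_zero, hf0] at h3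
    rwa [add_comm] at h3
  have hcoe : Tendsto (fun t : ℝ≥0 => (t : ℝ)) (𝓝[>] 0) (𝓝[≠] 0) := by
    refine tendsto_nhdsWithin_iff.2 ⟨?_, ?_⟩
    · exact (NNReal.continuous_coe.tendsto 0).mono_left nhdsWithin_le_nhds
    · filter_upwards [self_mem_nhdsWithin] with t ht
      exact (NNReal.coe_pos.2 ht).ne'
  have hmem : (F 1, l • F 1 + (f 1 - y)) ∈ A.graph := by
    refine (hA _ _).2 ((hG.tendsto_slope.comp hcoe).congr fun t => ?_)
    have hF0 : F 0 = 0 := intervalIntegral.integral_same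
    have := hTu t t.2
    rw [Real.toNNReal_coe] at this
    rw [Function.comp_apply, slope_def_module, this, ← Complex.ofReal_inv, Complex.coe_smul]
    simp [hF0]
  obtain ⟨x, hx, hx'⟩ := A.mem_graph_iff.1 hmem
  refine ⟨x, ?_⟩
  rw [hx', hx, Complex.coe_smul]
  simp [hf]

/-- `l - A` is surjective for the generator `A` of a contraction semigroup and `l > 0`. -/
theorem IsGenerator.surjective [CompleteSpace X] {A : X →ₗ.[ℂ] X} {T : ℝ≥0 → X →L[ℂ] X}
    (hA : IsGenerator A T) (hT : IsContractionSemigroup T) {l : ℝ} (hl : 0 < l) (y : X) :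
    ∃ x : A.domain, (l : ℂ) • (x : X) - A x = y := by
  -- Makes `1 - e^(-l) T 1` invertible, so the right-hand side of `exists_sub_eq` can be any vector.
  have hn : ‖Real.exp (-l) • T 1‖ < 1 := by
    rw [norm_smul, Real.norm_of_nonneg (Real.exp_pos _).le]
    refine (mul_le_of_le_one_right (Real.exp_pos _).le (hT.contractive 1)).trans_lt ?_
    rw [Real.exp_lt_one_iff]
    linarith
  obtain ⟨u, hu⟩ := isUnit_one_sub_of_norm_lt_one hn
  obtain ⟨x, hx⟩ := hA.exists_sub_eq hT l ((↑u⁻¹ : X →L[ℂ] X) y)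
  refine ⟨x, hx.trans ?_⟩
  have h := congrArg (fun L : X →L[ℂ] X => L y) u.mul_inv
  rw [hu] at h
  exact h

/-- Bounded perturbations of maximal dissipative operators have full range. -/
theorem IsDissipative.exists_sub_add_eq [CompleteSpace X] {A : X →ₗ.[ℂ] X} (hA : IsDissipative A)
    {l : ℝ} (hl : 0 < l) (hr : ∀ y : X, ∃ x : A.domain, (l : ℂ) • (x : X) - A x = y)
    (P : X →L[ℂ] X) (hP : ‖P‖ < l) (y : X) :
    ∃ x : A.domain, (l : ℂ) • (x : X) - A x + P x = y := by
  obtain ⟨R, hRb, hR, -⟩ := hA.exists_resolvent hl hr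
  -- Since `(l - A + P) R = 1 + P R`, a Neumann series suffices.
  have hn : ‖-(P * R)‖ < 1 := by
    have h1 : ‖R‖ ≤ l⁻¹ := R.opNorm_le_bound (by positivity) fun x => by
      rw [inv_mul_eq_div, le_div_iff₀ hl, mul_comm]
      exact hRb x
    rw [norm_neg]
    calc ‖P * R‖ ≤ ‖P‖ * ‖R‖ := norm_mul_le _ _
      _ ≤ ‖P‖ * l⁻¹ := by gcongr
      _ < 1 := by rwa [← div_eq_mul_inv, div_lt_one hl]
  obtain ⟨u, hu⟩ := isUnit_one_sub_of_norm_lt_one hn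
  obtain ⟨x, hx, hx'⟩ := hR ((↑u⁻¹ : X →L[ℂ] X) y)
  refine ⟨x, ?_⟩
  have h := congrArg (fun L : X →L[ℂ] X => L y) u.mul_inv
  rw [hu, sub_neg_eq_add] at h
  rw [hx', hx]
  exact h

/-- For a closed dissipative operator `A` and `l > 0`, `l - A` is surjective as soon as its range
has trivial orthogonal complement. -/
theorem IsDissipative.surjective_of_isClosed [CompleteSpace X] {A : X →ₗ.[ℂ] X}
    (hA : IsDissipative A) (hc : A.IsClosed) {l : ℝ} (hl : 0 < l)
    (h0 : ∀ y : X, (∀ x : A.domain, inner ℂ ((l : ℂ) • (x : X) - A x) y = 0) → y = 0) (y : X) :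
    ∃ x : A.domain, (l : ℂ) • (x : X) - A x = y := by
  let L : A.domain →ₗ[ℂ] X := (l : ℂ) • A.domain.subtype - A.toFun
  have hLapply : ∀ x, L x = (l : ℂ) • (x : X) - A x := fun _ => rfl
  have hbound : ∀ x : A.domain, ‖x‖ ≤ l⁻¹ * ‖L x‖ := fun x => by
    rw [inv_mul_eq_div, le_div_iff₀ hl, mul_comm]
    exact hA.mul_norm_le l x
  -- `L = l - A` is bounded below, so convergent images have Cauchy preimages, and closedness of `A`
  -- identifies the limit.
  have hcl : IsClosed (LinearMap.range L : Set X) := by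
    refine IsSeqClosed.isClosed fun v z hv hz => ?_
    choose u hu using hv
    have hcau : CauchySeq fun n => (u n : X) := by
      rw [Metric.cauchySeq_iff]
      intro ε hε
      obtain ⟨N, hN⟩ := Metric.cauchySeq_iff.1 hz.cauchySeq (l * ε) (by positivity)
      refine ⟨N, fun m hm n hn => ?_⟩
      have h1 := hbound (u m - u n)
      rw [map_sub, hu, hu, ← dist_eq_norm (v m), inv_mul_eq_div, le_div_iff₀ hl, mul_comm] at h1
      rw [dist_eq_norm]
      exact lt_of_mul_lt_mul_left (h1.trans_lt (hN m hm n hn)) hl.le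
    obtain ⟨x, hx⟩ := cauchySeq_tendsto_of_complete hcau
    have hAx : Tendsto (fun n => A (u n)) atTop (𝓝 ((l : ℂ) • x - z)) := by
      refine ((hx.const_smul (l : ℂ)).sub hz).congr fun n => ?_
      rw [← hu, hLapply, sub_sub_cancel]
    have hmem : (x, (l : ℂ) • x - z) ∈ A.graph :=
      hc.mem_of_tendsto (hx.prodMk_nhds hAx) (.of_forall fun n => A.mem_graph (u n))
    obtain ⟨w, rfl, hw⟩ := A.mem_graph_iff.1 hmem
    exact ⟨w, by rw [hLapply, hw, sub_sub_cancel]⟩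
  have htop : LinearMap.range L = ⊤ := by
    have h := (Submodule.topologicalClosure_eq_top_iff (K := LinearMap.range L)).2 (by
      rw [Submodule.eq_bot_iff]
      exact fun y hy => h0 y fun x => (Submodule.mem_orthogonal _ _).1 hy _ ⟨x, rfl⟩)
    rwa [hcl.submodule_topologicalClosure_eq] at h
  exact LinearMap.range_eq_top.1 htop y

end Dissipative

/-! ### The double adjoint -/

section Adjoint

variable {E F : Type*} [NormedAddCommGroup E] [InnerProductSpace ℂ E] [CompleteSpace E]
  [NormedAddCommGroup F] [InnerProductSpace ℂ F] [CompleteSpace F]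

/-- A closed densely defined operator contains the adjoint of its adjoint. -/
theorem mem_graph_of_inner_adjoint {A : E →ₗ.[ℂ] F} (hd : Dense (A.domain : Set E))
    (hc : A.IsClosed) {x : E} {y : F} (h : ∀ b : A†.domain, inner ℂ y (b : F) = inner ℂ x (A† b)) :
    (x, y) ∈ A.graph := by
  let e := WithLp.prodContinuousLinearEquiv 2 ℂ E F
  let K : Submodule ℂ (WithLp 2 (E × F)) := A.graph.comap e.toLinearEquiv.toLinearMap
  have hK : IsClosed (K : Set (WithLp 2 (E × F))) := hc.preimage e.continuous
  -- The graph is a closed subspace, hence its own double complement; vectors `u` of `Kᗮ` satisfy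
  -- `u.fst = -A† u.snd`.
  have hKK : Kᗮᗮ = K := by
    rw [Submodule.orthogonal_orthogonal_eq_closure, hK.submodule_topologicalClosure_eq]
  suffices WithLp.toLp 2 (x, y) ∈ K from this
  rw [← hKK, Submodule.mem_orthogonal]
  intro u hu
  have h1 : ∀ a : A.domain, inner ℂ (-u.fst) (a : E) = inner ℂ u.snd (A a) := fun a => by
    have h2 := (Submodule.mem_orthogonal' _ _).1 hu (WithLp.toLp 2 ((a : E), A a))
      (A.mem_graph a)
    rw [WithLp.prod_inner_apply] at h2
    rw [inner_neg_left]
    exact neg_eq_of_add_eq_zero_right h2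
  have hmem : u.snd ∈ A†.domain := LinearPMap.mem_adjoint_domain_of_exists _ ⟨_, h1⟩
  have h3 : A† ⟨u.snd, hmem⟩ = -u.fst := LinearPMap.adjoint_apply_eq hd _ h1
  have h4 := h ⟨u.snd, hmem⟩
  rw [h3, inner_neg_right, ← inner_conj_symm, ← inner_conj_symm x, ← map_neg] at h4
  have h5 := star_injective h4
  rw [WithLp.prod_inner_apply]
  change inner ℂ u.fst x + inner ℂ u.snd y = 0
  rw [h5, add_neg_cancel]

end Adjoint

/-! ### Block operators -/

section Block

variable {H₁ H₂ : Type*} [NormedAddCommGroup H₁] [InnerProductSpace ℂ H₁]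
  [NormedAddCommGroup H₂] [InnerProductSpace ℂ H₂]

/-- `C` is the block operator `(a, b) ↦ (P a + D b, A a)` on `dom A × dom D`. -/
def IsBlockOperator (C : WithLp 2 (H₁ × H₂) →ₗ.[ℂ] WithLp 2 (H₁ × H₂)) (P : H₁ →L[ℂ] H₁)
    (A : H₁ →ₗ.[ℂ] H₂) (D : H₂ →ₗ.[ℂ] H₁) : Prop :=
  ∀ x y : WithLp 2 (H₁ × H₂), (x, y) ∈ C.graph ↔ ∃ (a : A.domain) (b : D.domain),
    x = WithLp.toLp 2 ((a : H₁), (b : H₂)) ∧ y = WithLp.toLp 2 (P a + D b, A a)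

variable {C : WithLp 2 (H₁ × H₂) →ₗ.[ℂ] WithLp 2 (H₁ × H₂)} {P : H₁ →L[ℂ] H₁}
  {A : H₁ →ₗ.[ℂ] H₂} {D : H₂ →ₗ.[ℂ] H₁}

theorem IsEverywhereBounded.exists_clm {E F : Type*} [NormedAddCommGroup E] [NormedSpace ℂ E]
    [NormedAddCommGroup F] [NormedSpace ℂ F] {B : E →ₗ.[ℂ] F} (hB : IsEverywhereBounded B) :
    ∃ P : E →L[ℂ] F, ∀ x : B.domain, B x = P x := by
  obtain ⟨htop, c, hc⟩ := hB
  have hm : ∀ x, x ∈ B.domain := fun x => htop ▸ Submodule.mem_top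
  let f : E →ₗ[ℂ] F := B.toFun.comp (LinearMap.id.codRestrict B.domain hm)
  exact ⟨f.mkContinuous c fun x => hc ⟨x, hm x⟩, fun x => rfl⟩

theorem Splits.isBlockOperator {A₁ : WithLp 2 (H₁ × H₂) →ₗ.[ℂ] H₁} {A₁₁ : H₁ →ₗ.[ℂ] H₁}
    (hs : Splits A₁ A₁₁ D) (htop : A₁₁.domain = ⊤) (hP : ∀ x : A₁₁.domain, A₁₁ x = P x) :
    IsBlockOperator (Aext A₁ A) P A D := by
  have hm : ∀ x, x ∈ A₁₁.domain := fun x => htop ▸ Submodule.mem_top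
  have happ : ∀ (x : A₁.domain) (h : (x : WithLp 2 (H₁ × H₂)).snd ∈ D.domain),
      A₁ x = P (x : WithLp 2 (H₁ × H₂)).fst + D ⟨_, h⟩ := fun x h => by
    rw [hs.apply_eq x (hm _) h, hP]
  intro x y
  rw [LinearPMap.mem_graph_iff]
  constructor
  · rintro ⟨z, rfl, rfl⟩
    have hz : (z : WithLp 2 (H₁ × H₂)).snd ∈ D.domain := ((hs.mem_domain_iff _).1 z.2.1).2
    exact ⟨⟨_, z.2.2⟩, ⟨_, hz⟩, rfl, congrArg (fun w => WithLp.toLp 2 (w, A ⟨_, z.2.2⟩))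
      (happ ⟨z, z.2.1⟩ hz)⟩
  · rintro ⟨a, b, rfl, rfl⟩
    have h1 : WithLp.toLp 2 ((a : H₁), (b : H₂)) ∈ A₁.domain :=
      (hs.mem_domain_iff _).2 ⟨hm _, b.2⟩
    exact ⟨⟨_, h1, a.2⟩, rfl, congrArg (fun w => WithLp.toLp 2 (w, A a)) (happ ⟨_, h1⟩ b.2)⟩

theorem IsBlockOperator.exists_apply (hC : IsBlockOperator C P A D) (a : A.domain) (b : D.domain) :
    ∃ x : C.domain, (x : WithLp 2 (H₁ × H₂)) = WithLp.toLp 2 ((a : H₁), (b : H₂)) ∧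
      C x = WithLp.toLp 2 (P a + D b, A a) :=
  LinearPMap.mem_graph_iff C |>.1 ((hC _ _).2 ⟨a, b, rfl, rfl⟩)

theorem IsBlockOperator.apply_eq (hC : IsBlockOperator C P A D) (x : C.domain) :
    ∃ (a : A.domain) (b : D.domain),
      (x : WithLp 2 (H₁ × H₂)) = WithLp.toLp 2 ((a : H₁), (b : H₂)) ∧
      C x = WithLp.toLp 2 (P a + D b, A a) :=
  (hC _ _).1 (C.mem_graph x)

theorem IsBlockOperator.isDissipative_iff (hC : IsBlockOperator C P A D) :
    IsDissipative C ↔ ∀ (a : A.domain) (b : D.domain),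
      (inner ℂ (P a) (a : H₁) + inner ℂ (D b) (a : H₁) + inner ℂ (A a) (b : H₂)).re ≤ 0 := by
  have key : ∀ (a : A.domain) (b : D.domain),
      inner ℂ (WithLp.toLp 2 (P a + D b, A a)) (WithLp.toLp 2 ((a : H₁), (b : H₂))) =
        inner ℂ (P a) (a : H₁) + inner ℂ (D b) (a : H₁) + inner ℂ (A a) (b : H₂) := fun a b => by
    rw [WithLp.prod_inner_apply, ← inner_add_left]
  constructor
  · intro h a b
    obtain ⟨x, hx, hx'⟩ := hC.exists_apply a b
    rw [← key, ← hx, ← hx']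
    exact h x
  · intro h x
    obtain ⟨a, b, hx, hx'⟩ := hC.apply_eq x
    rw [hx, hx', key]
    exact h a b

/-- A dissipative block operator has dissipative diagonal on `dom A`, and its off-diagonal entries
are formally skew-adjoint to each other. -/
theorem IsBlockOperator.inner_eq_neg (hC : IsBlockOperator C P A D) (h : IsDissipative C)
    (a : A.domain) (b : D.domain) : inner ℂ (D b) (a : H₁) = -inner ℂ (b : H₂) (A a) := by
  rw [hC.isDissipative_iff] at h
  set w : ℂ := inner ℂ (D b) (a : H₁) + inner ℂ (b : H₂) (A a) with hw
  have h1 : ∀ c : ℂ, (inner ℂ (P a) (a : H₁)).re + ((starRingEnd ℂ) c * w).re ≤ 0 := fun c => by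
    have h2 := h a (c • b)
    rw [D.map_smul, Submodule.coe_smul, inner_smul_left, inner_smul_right, Complex.add_re,
      Complex.add_re] at h2
    have h3 : (c * inner ℂ (A a) (b : H₂)).re
        = ((starRingEnd ℂ) c * inner ℂ (b : H₂) (A a)).re := by
      rw [← inner_conj_symm, ← Complex.conj_re, map_mul, Complex.conj_conj]
    rw [hw, mul_add, Complex.add_re]
    linarith
  have h4 : w = 0 := by
    by_contra h0
    have hpos : 0 < Complex.normSq w := Complex.normSq_pos.2 h0
    -- This `c` makes `Re (conj c * w) = 1 - Re ⟪P a, a⟫`, so `h1` would read `1 ≤ 0`.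
    have h5 := h1 (((1 - (inner ℂ (P a) (a : H₁)).re) / Complex.normSq w : ℝ) * w)
    rw [map_mul, Complex.conj_ofReal, mul_assoc, ← Complex.normSq_eq_conj_mul_self,
      ← Complex.ofReal_mul, Complex.ofReal_re, div_mul_cancel₀ _ hpos.ne'] at h5
    linarith
  exact eq_neg_of_add_eq_zero_left h4

theorem IsBlockOperator.dense_fst (hC : IsBlockOperator C P A D)
    (hd : Dense (C.domain : Set (WithLp 2 (H₁ × H₂)))) : Dense (A.domain : Set H₁) := by
  have hs : Function.Surjective (WithLp.fst : WithLp 2 (H₁ × H₂) → H₁) := fun x =>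
    ⟨WithLp.toLp 2 (x, 0), rfl⟩
  refine (hs.denseRange.dense_image (WithLp.prod_continuous_ofLp 2 H₁ H₂).fst hd).mono ?_
  rintro _ ⟨x, hx, rfl⟩
  obtain ⟨a, b, h, -⟩ := hC.apply_eq ⟨x, hx⟩
  rw [show x = _ from h]
  exact a.2

theorem IsBlockOperator.dense_snd (hC : IsBlockOperator C P A D)
    (hd : Dense (C.domain : Set (WithLp 2 (H₁ × H₂)))) : Dense (D.domain : Set H₂) := by
  have hs : Function.Surjective (WithLp.snd : WithLp 2 (H₁ × H₂) → H₂) := fun x =>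
    ⟨WithLp.toLp 2 (0, x), rfl⟩
  refine (hs.denseRange.dense_image (WithLp.prod_continuous_ofLp 2 H₁ H₂).snd hd).mono ?_
  rintro _ ⟨x, hx, rfl⟩
  obtain ⟨a, b, h, -⟩ := hC.apply_eq ⟨x, hx⟩
  rw [show x = _ from h]
  exact b.2

/-- Taking the second component `0`, in `dom D`, embeds the graph of `A` continuously into that of
`C`. -/
theorem IsBlockOperator.isClosed_fst (hC : IsBlockOperator C P A D) (hc : C.IsClosed) :
    A.IsClosed := by
  have h : (A.graph : Set (H₁ × H₂)) = (fun p : H₁ × H₂ =>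
      ((WithLp.toLp 2 (p.1, 0), WithLp.toLp 2 (P p.1, p.2)) :
        WithLp 2 (H₁ × H₂) × WithLp 2 (H₁ × H₂))) ⁻¹' C.graph := by
    ext ⟨x, y⟩
    simp only [SetLike.mem_coe, Set.mem_preimage]
    rw [hC, LinearPMap.mem_graph_iff]
    constructor
    · rintro ⟨a, rfl, rfl⟩
      exact ⟨a, 0, by simp, by simp⟩
    · rintro ⟨a, b, h1, h2⟩
      have h3 := (WithLp.toLp_injective 2) h1
      have h4 := (WithLp.toLp_injective 2) h2
      exact ⟨a, (congrArg Prod.fst h3).symm, (congrArg Prod.snd h4).symm⟩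
  rw [LinearPMap.IsClosed, h]
  refine hc.preimage (Continuous.prodMk ?_ ?_)
  · exact (WithLp.prod_continuous_toLp 2 H₁ H₂).comp (by fun_prop)
  · exact (WithLp.prod_continuous_toLp 2 H₁ H₂).comp (by fun_prop)

theorem isClosed_neg {A : H₁ →ₗ.[ℂ] H₂} (hA : A.IsClosed) : (-A).IsClosed := by
  have h : ((-A).graph : Set (H₁ × H₂)) = (fun p : H₁ × H₂ => (p.1, -p.2)) ⁻¹' A.graph := by
    ext ⟨x, y⟩
    simp only [SetLike.mem_coe, Set.mem_preimage]
    rw [LinearPMap.mem_graph_iff, LinearPMap.mem_graph_iff]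
    constructor
    · rintro ⟨a, rfl, rfl⟩
      exact ⟨a, rfl, by rw [LinearPMap.neg_apply, neg_neg]⟩
    · rintro ⟨a, rfl, h⟩
      exact ⟨a, rfl, by rw [LinearPMap.neg_apply]; exact neg_eq_iff_eq_neg.2 h⟩
  rw [LinearPMap.IsClosed, h]
  exact hA.preimage (by fun_prop)

theorem IsBlockOperator.isClosed (hC : IsBlockOperator C P A D) (hA : A.IsClosed)
    (hD : D.IsClosed) : C.IsClosed := by
  have h : (C.graph : Set (WithLp 2 (H₁ × H₂) × WithLp 2 (H₁ × H₂))) =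
      (fun p => (p.1.fst, p.2.snd)) ⁻¹' A.graph ∩
        (fun p => (p.1.snd, p.2.fst - P p.1.fst)) ⁻¹' D.graph := by
    ext ⟨x, y⟩
    simp only [SetLike.mem_coe, Set.mem_preimage, Set.mem_inter_iff]
    rw [hC, LinearPMap.mem_graph_iff, LinearPMap.mem_graph_iff]
    constructor
    · rintro ⟨a, b, rfl, rfl⟩
      exact ⟨⟨a, rfl, rfl⟩, b, rfl, (add_sub_cancel_left _ _).symm⟩
    · rintro ⟨⟨a, h1, h2⟩, b, h3, h4⟩
      refine ⟨a, b, ?_, ?_⟩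
      · rw [h1, h3]
        rfl
      · rw [h2, h4, h1, add_sub_cancel]
        rfl
  have hf : Continuous (WithLp.fst : WithLp 2 (H₁ × H₂) → H₁) :=
    (WithLp.prod_continuous_ofLp 2 H₁ H₂).fst
  have hs : Continuous (WithLp.snd : WithLp 2 (H₁ × H₂) → H₂) :=
    (WithLp.prod_continuous_ofLp 2 H₁ H₂).snd
  rw [LinearPMap.IsClosed, h]
  refine (IsClosed.preimage ?_ hA).inter (IsClosed.preimage ?_ hD)
  · exact (hf.comp continuous_fst).prodMk (hs.comp continuous_snd)
  · exact (hs.comp continuous_fst).prodMk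
      ((hf.comp continuous_snd).sub (P.continuous.comp (hf.comp continuous_fst)))

variable [CompleteSpace H₁] [CompleteSpace H₂]

/-- Skewness gives `D ≤ -A†`. For `y` in `dom A†`, solve the equation that `(0, -y)` would satisfy
if `D` were `-A†` and `P` zero; the solution must have second component `-y`, which is thus in `dom
D`. -/
theorem IsBlockOperator.eq_neg_adjoint (hC : IsBlockOperator C P A D) (hd : IsDissipative C)
    (hr : ∀ l : ℝ, 0 < l → ∀ y : WithLp 2 (H₁ × H₂), ∃ x : C.domain,
      (l : ℂ) • (x : WithLp 2 (H₁ × H₂)) - C x = y)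
    (hA : Dense (A.domain : Set H₁)) : D = -A† := by
  have hskew := hC.inner_eq_neg hd
  have hle : D ≤ -A† := by
    have h1 : ∀ (b : D.domain) (a : A.domain), inner ℂ (-D b) (a : H₁) = inner ℂ (b : H₂) (A a) :=
      fun b a => by rw [inner_neg_left, hskew, neg_neg]
    refine ⟨fun b hb => LinearPMap.mem_adjoint_domain_of_exists _ ⟨_, h1 ⟨b, hb⟩⟩, ?_⟩
    intro b b' hbb'
    have h2 := LinearPMap.adjoint_apply_eq hA b' (x₀ := -D b) fun a => by rw [h1, hbb']
    rw [LinearPMap.neg_apply]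
    exact (neg_eq_iff_eq_neg.2 h2).symm
  refine LinearPMap.eq_of_le_of_domain_eq hle (le_antisymm hle.1 fun y hy => ?_)
  let e := WithLp.prodContinuousLinearEquiv 2 ℂ H₁ H₂
  let Q : WithLp 2 (H₁ × H₂) →L[ℂ] WithLp 2 (H₁ × H₂) :=
    (e.symm : H₁ × H₂ →L[ℂ] WithLp 2 (H₁ × H₂)) ∘L
      (ContinuousLinearMap.inl ℂ H₁ H₂ ∘L P ∘L ContinuousLinearMap.fst ℂ H₁ H₂) ∘L
        (e : WithLp 2 (H₁ × H₂) →L[ℂ] H₁ × H₂)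
  have hQ : ∀ x, Q x = WithLp.toLp 2 (P x.fst, 0) := fun _ => rfl
  -- Large enough to cancel the diagonal block `P` by a bounded perturbation.
  set l : ℝ := ‖Q‖ + 1 with hl
  have hl0 : 0 < l := by positivity
  obtain ⟨x, hx⟩ := hd.exists_sub_add_eq hl0 (hr l hl0) Q (by linarith)
    (WithLp.toLp 2 (-A† ⟨y, hy⟩, -((l : ℂ) • y)))
  obtain ⟨a, b, hxab, hCx⟩ := hC.apply_eq x
  rw [hCx, hQ, hxab] at hx
  have h1 : (l : ℂ) • (a : H₁) - (P a + D b) + P a = -A† ⟨y, hy⟩ := congrArg WithLp.fst hx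
  have h2 : (l : ℂ) • (b : H₂) - A a + 0 = -((l : ℂ) • y) := congrArg WithLp.snd hx
  have h3 : A a = (l : ℂ) • ((b : H₂) + y) := by
    rw [smul_add, ← sub_eq_zero, ← sub_eq_zero.2 h2.symm]
    abel
  have h4 : (l : ℂ) • (a : H₁) = D b - A† ⟨y, hy⟩ := by
    rw [sub_eq_add_neg, ← h1]
    abel
  -- Yields `l ‖a‖² = -l ‖b + y‖²`, so both sides vanish.
  have h5 : inner ℂ ((l : ℂ) • (a : H₁)) (a : H₁)
      = -inner ℂ ((b : H₂) + y) ((l : ℂ) • ((b : H₂) + y)) := by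
    rw [h4, inner_sub_left, hskew, LinearPMap.adjoint_isFormalAdjoint hA ⟨y, hy⟩ a, ← h3,
      inner_add_left]
    ring
  have h6 : l * ‖(a : H₁)‖ ^ 2 = -(l * ‖(b : H₂) + y‖ ^ 2) := by
    have h7 := congrArg Complex.re h5
    rw [inner_smul_left, inner_smul_right, Complex.conj_ofReal, Complex.neg_re,
      Complex.re_ofReal_mul, Complex.re_ofReal_mul] at h7
    have h8 : ∀ z : H₁, (inner ℂ z z).re = ‖z‖ ^ 2 := inner_self_eq_norm_sq (𝕜 := ℂ)
    have h9 : ∀ z : H₂, (inner ℂ z z).re = ‖z‖ ^ 2 := inner_self_eq_norm_sq (𝕜 := ℂ)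
    rwa [h8, h9] at h7
  have h10 : ‖(b : H₂) + y‖ ^ 2 = 0 := by
    nlinarith [sq_nonneg ‖(a : H₁)‖, sq_nonneg ‖(b : H₂) + y‖]
  have h11 : y = -(b : H₂) := by
    rw [eq_neg_iff_add_eq_zero, add_comm]
    exact norm_eq_zero.1 ((pow_eq_zero_iff two_ne_zero).1 h10)
  rw [h11]
  exact D.domain.neg_mem b.2

theorem IsBlockOperator.generates (hC : IsBlockOperator C P A (-A†))
    (hA : Dense (A.domain : Set H₁)) (hAc : A.IsClosed)
    (hP : ∀ x, (inner ℂ (P x) x).re ≤ 0) : GeneratesContractionSemigroup C := by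
  have hadj := LinearPMap.adjoint_isFormalAdjoint hA
  have hd : IsDissipative C := hC.isDissipative_iff.2 fun a b => by
    have h1 : inner ℂ ((-A†) b) (a : H₁) = -inner ℂ (b : H₂) (A a) := by
      rw [LinearPMap.neg_apply, inner_neg_left]
      exact congrArg Neg.neg (hadj b a)
    have h2 : (inner ℂ (b : H₂) (A a)).re = (inner ℂ (A a) (b : H₂)).re := by
      rw [← inner_conj_symm, Complex.conj_re]
    rw [h1, Complex.add_re, Complex.add_re, Complex.neg_re, h2]
    linarith [hP a]
  have hc : C.IsClosed := hC.isClosed hAc (isClosed_neg (LinearPMap.adjoint_isClosed hA))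
  refine hd.generates fun l hl => hd.surjective_of_isClosed hc hl fun y hy => ?_
  -- Testing on `(a, 0)` puts `y.snd` in `dom A†`; testing on `(0, b)` gives `A y.fst = -l y.snd`
  -- through the double adjoint. So `y` is in `dom C` and may be tested against itself.
  have hy' : ∀ (a : A.domain) (b : (-A†).domain),
      inner ℂ ((l : ℂ) • (a : H₁) - (P a + (-A†) b)) y.fst +
        inner ℂ ((l : ℂ) • (b : H₂) - A a) y.snd = 0 := fun a b => by
    obtain ⟨x, hx, hx'⟩ := hC.exists_apply a b
    have := hy x
    rw [hx, hx', WithLp.prod_inner_apply] at this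
    exact this
  have h1 : ∀ a : A.domain,
      inner ℂ ((l : ℂ) • y.fst - P.adjoint y.fst) (a : H₁) = inner ℂ y.snd (A a) := fun a => by
    have h2 := hy' a 0
    rw [LinearPMap.map_zero, add_zero, Submodule.coe_zero, smul_zero, zero_sub, inner_neg_left,
      ← sub_eq_add_neg, sub_eq_zero, inner_sub_left, inner_smul_left, Complex.conj_ofReal] at h2
    rw [inner_sub_left, inner_smul_left, Complex.conj_ofReal,
      ContinuousLinearMap.adjoint_inner_left, ← inner_conj_symm y.snd, ← h2, map_sub, map_mul,
      Complex.conj_ofReal, inner_conj_symm, inner_conj_symm]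
  have hmem : y.snd ∈ A†.domain := LinearPMap.mem_adjoint_domain_of_exists _ ⟨_, h1⟩
  have h3 : (y.fst, -((l : ℂ) • y.snd)) ∈ A.graph := by
    refine mem_graph_of_inner_adjoint hA hAc fun b => ?_
    have h2 := hy' 0 b
    rw [LinearPMap.map_zero, sub_zero, Submodule.coe_zero, smul_zero, map_zero, zero_add, zero_sub,
      LinearPMap.neg_apply, neg_neg, inner_smul_left, Complex.conj_ofReal] at h2
    have h4 := congrArg (starRingEnd ℂ) (eq_neg_of_add_eq_zero_left h2)
    rw [inner_conj_symm, map_neg, map_mul, Complex.conj_ofReal, inner_conj_symm] at h4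
    rw [inner_neg_left, inner_smul_left, Complex.conj_ofReal]
    exact h4.symm
  obtain ⟨a, ha, -⟩ := A.mem_graph_iff.1 h3
  obtain ⟨x, hx, -⟩ := hC.exists_apply a ⟨y.snd, hmem⟩
  have hxy : (x : WithLp 2 (H₁ × H₂)) = y := by
    rw [hx, ha]
    rfl
  have h5 := hd.mul_norm_sq_le l x
  have h6 := hy x
  rw [← hxy] at h6
  rw [h6, Complex.zero_re] at h5
  rw [← hxy]
  have h7 : ‖(x : WithLp 2 (H₁ × H₂))‖ ^ 2 = 0 := by
    nlinarith [sq_nonneg ‖(x : WithLp 2 (H₁ × H₂))‖]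
  exact norm_eq_zero.1 ((pow_eq_zero_iff two_ne_zero).1 h7)

theorem IsBlockOperator.generates_iff (hC : IsBlockOperator C P A D) :
    GeneratesContractionSemigroup C ↔ Dense (A.domain : Set H₁) ∧ A.IsClosed ∧
      Dense (D.domain : Set H₂) ∧ D.IsClosed ∧ D = -A† ∧ ∀ x, (inner ℂ (P x) x).re ≤ 0 := by
  constructor
  · rintro ⟨T, hT, hG⟩
    have hd := hG.isDissipative hT
    have hr : ∀ l : ℝ, 0 < l → ∀ y : WithLp 2 (H₁ × H₂), ∃ x : C.domain,
      (l : ℂ) • (x : WithLp 2 (H₁ × H₂)) - C x = y := fun l hl => hG.surjective hT hl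
    have hdense := hd.dense_domain one_pos (hr 1 one_pos)
    have hc := hd.isClosed one_pos (hr 1 one_pos)
    have hA := hC.dense_fst hdense
    have hD := hC.eq_neg_adjoint hd hr hA
    refine ⟨hA, hC.isClosed_fst hc, hC.dense_snd hdense, ?_, hD, fun x => ?_⟩
    · rw [hD]
      exact isClosed_neg (LinearPMap.adjoint_isClosed hA)
    -- Dissipativity at `(a, 0)` gives the claim on `dom A`; continuity of `P` extends it.
    · refine hA.induction (P := fun x => (inner ℂ (P x) x).re ≤ 0) (fun a ha => ?_) ?_ x
      · simpa using hC.isDissipative_iff.1 hd ⟨a, ha⟩ 0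
      · exact isClosed_le (by fun_prop) continuous_const
  · rintro ⟨hA, hAc, -, -, rfl, hP⟩
    exact hC.generates hA hAc hP

end Block

end ClosureRelation

/-! ### The main theorem -/

theorem mainTheorem6 {H₁ H₂ : Type*}
    [NormedAddCommGroup H₁] [InnerProductSpace ℂ H₁] [CompleteSpace H₁]
    [NormedAddCommGroup H₂] [InnerProductSpace ℂ H₂] [CompleteSpace H₂]
    (A₁ : WithLp 2 (H₁ × H₂) →ₗ.[ℂ] H₁) (A₂₁ : H₁ →ₗ.[ℂ] H₂)
    (S : H₂ →L[ℂ] H₂) (hS : ClosureRelation.IsCoerciveOp S)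
    (A₁₁ : H₁ →ₗ.[ℂ] H₁) (A₁₂ : H₂ →ₗ.[ℂ] H₁)
    (hsplit : ClosureRelation.Splits A₁ A₁₁ A₁₂)
    (hA₁₁ : ClosureRelation.IsEverywhereBounded A₁₁) :
    ((Dense (A₂₁.domain : Set H₁) ∧ A₂₁.IsClosed ∧
        Dense (A₁₂.domain : Set H₂) ∧ A₁₂.IsClosed ∧
        A₁₂ = -A₂₁† ∧ ClosureRelation.IsDissipative A₁₁) ↔
      ClosureRelation.GeneratesContractionSemigroup (ClosureRelation.Aext A₁ A₂₁)) ∧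
    (ClosureRelation.GeneratesContractionSemigroup (ClosureRelation.Aext A₁ A₂₁) →
      (∀ h : H₁, h ∈ (ClosureRelation.AS A₁ A₂₁ S).domain ↔
        ∃ h₂₁ : h ∈ A₂₁.domain, S (A₂₁ ⟨h, h₂₁⟩) ∈ A₂₁†.domain) ∧
      (∀ h : (ClosureRelation.AS A₁ A₂₁ S).domain,
        ∃ (h₁₁ : (h : H₁) ∈ A₁₁.domain) (h₂₁ : (h : H₁) ∈ A₂₁.domain)
          (hadj : S (A₂₁ ⟨h, h₂₁⟩) ∈ A₂₁†.domain),
          ClosureRelation.AS A₁ A₂₁ S h =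
            A₁₁ ⟨h, h₁₁⟩ - A₂₁† ⟨S (A₂₁ ⟨h, h₂₁⟩), hadj⟩)) := by
  obtain ⟨P, hP⟩ := hA₁₁.exists_clm
  have hm : ∀ x, x ∈ A₁₁.domain := fun x => hA₁₁.1 ▸ Submodule.mem_top
  have hC : ClosureRelation.IsBlockOperator (ClosureRelation.Aext A₁ A₂₁) P A₂₁ A₁₂ :=
    hsplit.isBlockOperator hA₁₁.1 hP
  have hdis : ClosureRelation.IsDissipative A₁₁ ↔ ∀ x, (inner ℂ (P x) x).re ≤ 0 :=
    ⟨fun h x => hP ⟨x, hm x⟩ ▸ h ⟨x, hm x⟩, fun h x => hP x ▸ h x⟩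
  refine ⟨by rw [hdis]; exact hC.generates_iff.symm, fun hgen => ?_⟩
  obtain ⟨-, -, -, -, rfl, -⟩ := hC.generates_iff.1 hgen
  -- `-A₂₁†` and `A₂₁†` share their domain by definition, so the splitting already describes `dom
  -- A_S`.
  refine ⟨fun h => ⟨fun ⟨h₂₁, hh⟩ => ⟨h₂₁, ((hsplit.mem_domain_iff _).1 hh).2⟩,
    fun ⟨h₂₁, hh⟩ => ⟨h₂₁, (hsplit.mem_domain_iff _).2 ⟨hm _, hh⟩⟩⟩, fun h => ?_⟩
  obtain ⟨h₂₁, hh⟩ := h.2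
  have hadj : S (A₂₁ ⟨h, h₂₁⟩) ∈ A₂₁†.domain := ((hsplit.mem_domain_iff _).1 hh).2
  refine ⟨hm _, h₂₁, hadj, ?_⟩
  rw [sub_eq_add_neg]
  exact hsplit.apply_eq ⟨_, hh⟩ (hm _) hadj
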